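/- Let $X$ and $Z$ be real Hausdorff topological vector spaces, let $C\subseteq Z$ be a convex and pointed cone with nonempty interior (that is, $tC\subseteq C$ for all $t\ge 0$, $C+C=C$, $C\cap(-C)=\{0\}$, $\operatorname{int}C\neq\emptyset$), and let $K\subseteq X$ be nonempty and convex. For convex $U\subseteq V\subseteq X$ put $$\operatorname{core}_V U=\{u\in U:\ U\cap\,]u,v]\neq\emptyset\ \text{ for all } v\in V\},\qquad ]u,v]=\{u+t(v-u): 0<t\le 1\}.$$ A map $\varphi:K\to Z$ is called $C$-convex on $K$ if $t\varphi(x)+(1-t)\varphi(y)-\varphi(tx+(1-t)y)\in C$ for all $x,y\in K$ and $t\in[0,1]$. Let $f,g:K\times K\to Z$, and suppose that there is a nonempty compact convex set $K_0\subseteq K$ such that the following hold. (i) For every $x\in K_0\setminus\operatorname{core}_K K_0$ there exists $y_0\in\operatorname{core}_K K_0$ with $f(x,y_0)+g(x,y_0)\in -C$. (ii) For every $y\in K_0$, every $x\in K_0$ and every net $(x_\alpha)\subseteq K_0$ with $\lim x_\alpha=x$, there exist a net $(z_\alpha)\subseteq Z$ (over the same directed set) and $z\in Z$ with $\lim z_\alpha=z$,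 such that $f(x_\alpha,y)+g(x_\alpha,y)-z_\alpha\in -C$ for all $\alpha$ and $f(x,y)+g(x,y)-z\in C$. (iii) $f$ is $C$-essentially quasimonotone relative to the second variable on $K_0$: for all $n\ge 1$, all $y_1,\dots,y_n\in K_0$ and all $\lambda_1,\dots,\lambda_n\ge 0$ with $\sum_{i=1}^n\lambda_i=1$, $$\sum_{i=1}^n\lambda_i f\Big(\sum_{j=1}^n\lambda_j y_j,\;y_i\Big)\notin-\operatorname{int}C.$$ (iv) For every $x\in K_0$ the maps $y\mapsto f(x,y)$ and $y\mapsto g(x,y)$ are $C$-convex on $K$. (v) For every $x\in K_0$, $f(x,x)\in -C\setminus(-\operatorname{int}C)$ and $g(x,x)=0$. Then there exists $x_0\in K$ such that $f(x_0,y)+g(x_0,y)\notin-\operatorname{int}C$ for all $y\in K$. -/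

import Mathlib

open Set Filter Topology
open scoped Pointwise

universe u v

/-- The algebraic interior of `U` relative to `V`:
`core_V U = {u ∈ U : U ∩ ]u, v] ≠ ∅ for all v ∈ V}`, where
`]u, v] = {u + t (v - u) : 0 < t ≤ 1}`. -/
def relCore {X : Type*} [AddCommGroup X] [Module ℝ X] (V U : Set X) : Set X :=
  {u ∈ U | ∀ v ∈ V, (U ∩ {z | ∃ t ∈ Ioc (0 : ℝ) 1, z = u + t • (v - u)}).Nonempty}

/-- `φ` is `C`-convex on the (convex) set `K`. -/
def CConvexOn {X Z : Type*} [AddCommGroup X] [Module ℝ X] [AddCommGroup Z] [Module ℝ Z]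
    (C : Set Z) (K : Set X) (φ : X → Z) : Prop :=
  ∀ x ∈ K, ∀ y ∈ K, ∀ t ∈ Icc (0 : ℝ) 1,
    t • φ x + (1 - t) • φ y - φ (t • x + (1 - t) • y) ∈ C

/-- The bifunction `f` is `C`-essentially quasimonotone relative to the second variable
on `K`. -/
def CEssentiallyQuasimonotoneOn {X Z : Type*} [AddCommGroup X] [Module ℝ X]
    [AddCommGroup Z] [Module ℝ Z] [TopologicalSpace Z]
    (C : Set Z) (K : Set X) (f : X → X → Z) : Prop :=
  ∀ (n : ℕ) (y : Fin n → X) (l : Fin n → ℝ),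
    (∀ i, y i ∈ K) → (∀ i, 0 ≤ l i) → ∑ i, l i = 1 →
      ∑ i, l i • f (∑ j, l j • y j) (y i) ∉ -interior C

/-- The net condition on `φ : K → Z`: for every `x ∈ K` and every net `(x_a)` in `K` converging
to `x` there is a net `(z_a)` in `Z` over the same directed set, converging to some `z`, with
`φ (x_a) - z_a ∈ -C` for all `a`, and `φ x - z ∈ C`.
Nets are indexed by directed sets living in the universe of `X`. -/
def NetCondition {X : Type u} {Z : Type v} [TopologicalSpace X] [TopologicalSpace Z]
    [AddCommGroup Z] (C : Set Z) (K : Set X) (φ : X → Z) : Prop :=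
  ∀ x ∈ K, ∀ (ι : Type u) [Preorder ι] [IsDirectedOrder ι] [Nonempty ι] (u : ι → X),
    (∀ a, u a ∈ K) → Tendsto u atTop (𝓝 x) →
      ∃ (w : ι → Z) (z : Z), Tendsto w atTop (𝓝 z) ∧
        (∀ a, φ (u a) - w a ∈ -C) ∧ φ x - z ∈ C

/-! Write F = f + g. The Knaster–Kuratowski–Mazurkiewicz (KKM) principle `IsCompact.kkm` is applied
on K₀ to the sets of x with F(x, y) ∉ -int C, closed by `NetCondition.isClosed`. Its covering
condition holds because, if a convex combination x of the y_i missed every set with nonzero weight,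
then the weighted sum of the F(x, y_i) would lie in -int C. As g(x, ·) is C-convex and g(x, x) = 0,
the weighted sum of the g(x, y_i) lies in C, so that of the f(x, y_i) would lie in -int C, against
quasimonotonicity. This gives x₀ solving the problem on K₀. To pass to K, take u in the core with
F(x₀, u) ∈ -C: x₀ itself if it lies in the core, otherwise the point y₀ from coercivity. A bad v ∈ K
would make all of ]u, v] bad by convexity, yet this segment meets K₀. KKM is reduced by compactness
to a simplex, where it follows from Scarf's lemma `exists_dominant_colorful`, a parity argument, on
finer and finer grids. -/

/-! ### Combinatorics: dominant sets and Scarf's lemma -/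

/-- A finite set is dominant for a family of rankings if every element is ranked, for some index,
no higher than all members of the set. -/
def IsDominant {I P : Type*} (r : I → P → ℕ) (S : Finset P) : Prop :=
  ∀ y, ∃ i, ∀ x ∈ S, r i y ≤ r i x

theorem IsDominant.mono {I P : Type*} {r : I → P → ℕ} {S S' : Finset P}
    (h : IsDominant r S) (hS : S' ⊆ S) : IsDominant r S' := fun y =>
  let ⟨i, hi⟩ := h y
  ⟨i, fun x hx => hi x (hS hx)⟩

/-- `x` has the highest rank for the index `k` among the elements lying above the threshold `m i`
for all the other indices `i`. -/
def IsTopAbove {I P : Type*} (r : I → P → ℕ) (m : I → P) (k : I) (x : P) : Prop :=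
  (∀ i, i ≠ k → r i (m i) < r i x) ∧
    ∀ y, (∀ i, i ≠ k → r i (m i) < r i y) → r k y ≤ r k x

theorem existsUnique_isTopAbove {I P : Type*} [Finite P] {r : I → P → ℕ}
    (hr : ∀ i, Function.Injective (r i)) {m : I → P} {k : I} {y : P}
    (hy : ∀ i, i ≠ k → r i (m i) < r i y) : ∃! x, IsTopAbove r m k x := by
  obtain ⟨x, hx, hmax⟩ := Set.exists_max_image {y | ∀ i, i ≠ k → r i (m i) < r i y} (r k)
    (Set.toFinite _) ⟨y, hy⟩
  refine ⟨x, ⟨hx, hmax⟩, fun x' hx' => hr k (le_antisymm (hmax _ hx'.1) (hx'.2 _ hx))⟩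

/-- A nonempty dominant set with one element less than there are indices: the elements completing
it to a larger dominant set are described by two distinct indices. -/
theorem IsDominant.exists_insert_iff {I P : Type*} [Fintype I] [DecidableEq I] [DecidableEq P]
    {r : I → P → ℕ} (hr : ∀ i, Function.Injective (r i)) {D : Finset P}
    (hD : IsDominant r D) (hne : D.Nonempty) (hcard : D.card + 1 = Fintype.card I) :
    ∃ (m : I → P) (a b : I), (∀ i, m i ∈ D) ∧ (∀ i, ∀ x ∈ D, r i (m i) ≤ r i x) ∧
      (∀ x, ¬ (IsTopAbove r m a x ∧ IsTopAbove r m b x)) ∧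
      ∀ x, (x ∉ D ∧ IsDominant r (insert x D)) ↔ (IsTopAbove r m a x ∨ IsTopAbove r m b x) := by
  choose m hm hmin using fun i => D.exists_min_image (r i) hne
  have hsurj : ∀ y ∈ D, ∀ i, (∀ x ∈ D, r i y ≤ r i x) → y = m i := fun y hy i hi =>
    hr i (le_antisymm (hi _ (hm i)) (hmin i y hy))
  have hsurj' : ∀ y ∈ D, ∃ i, y = m i := fun y hy => by
    obtain ⟨i, hi⟩ := hD y
    exact ⟨i, hsurj y hy i hi⟩
  -- The minimisers map the indices onto `D`, which has one element fewer, so exactly one pair `a`,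
  -- `b` collides; these are the two indices sought.
  obtain ⟨a, -, b, -, hab, hmab⟩ := Finset.exists_ne_map_eq_of_card_lt_of_maps_to
    (s := Finset.univ) (t := D) (by rw [Finset.card_univ]; omega) (f := m) (fun i _ => hm i)
  have hinj : ∀ a b, a ≠ b → m a = m b → Set.InjOn m (Finset.univ.erase a : Finset I) := by
    intro a b hab hmab
    rw [← Finset.card_image_iff]
    have : (Finset.univ.erase a).image m = D := by
      ext y
      simp only [Finset.mem_image, Finset.mem_erase, Finset.mem_univ, and_true]
      constructor
      · rintro ⟨i, -, rfl⟩
        exact hm i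
      · intro hy
        obtain ⟨i, rfl⟩ := hsurj' y hy
        by_cases hi : i = a
        · exact ⟨b, hab.symm, by rw [hi, hmab]⟩
        · exact ⟨i, hi, rfl⟩
    rw [this, Finset.card_erase_of_mem (Finset.mem_univ a), Finset.card_univ]
    omega
  have hia := hinj a b hab hmab
  have hib := hinj b a hab.symm hmab.symm
  have key : ∀ k, (k = a ∨ k = b) → ∀ x, IsTopAbove r m k x →
      x ∉ D ∧ IsDominant r (insert x D) := by
    rintro k hk x ⟨hx, hmax⟩
    refine ⟨fun hxD => ?_, fun y => ?_⟩
    · obtain ⟨i, rfl⟩ := hsurj' x hxD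
      by_cases hi : i = k
      · subst hi
        rcases hk with rfl | rfl
        · exact absurd (hx b hab.symm) (by rw [hmab]; exact lt_irrefl _)
        · exact absurd (hx a hab) (by rw [hmab]; exact lt_irrefl _)
      · exact lt_irrefl _ (hx i hi)
    · by_cases hy : ∀ i, i ≠ k → r i (m i) < r i y
      · obtain ⟨i, hi⟩ := hD y
        have : i = k := by
          by_contra hne
          exact absurd (hi _ (hm i)) (not_le.2 (hy i hne))
        subst this
        exact ⟨i, fun w hw => (Finset.mem_insert.1 hw).elim (fun h => h ▸ hmax y hy) (hi w)⟩
      · push Not at hy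
        obtain ⟨i, hik, hi⟩ := hy
        exact ⟨i, fun w hw => (Finset.mem_insert.1 hw).elim
          (fun h => h ▸ hi.trans (hx i hik).le) (fun h => hi.trans (hmin i w h))⟩
  refine ⟨m, a, b, hm, hmin, ?_, fun x => ⟨?_, ?_⟩⟩
  · rintro x ⟨h1, h2⟩
    obtain ⟨i, hi⟩ := hD x
    have := hi _ (hm i)
    by_cases h : i = a
    · exact absurd this (not_le.2 (h2.1 i (by rw [h]; exact hab)))
    · exact absurd this (not_le.2 (h1.1 i h))
  · rintro ⟨hxD, hdom⟩
    choose κ hκ using hdom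
    have hκinj : Set.InjOn κ (insert x D : Finset P) := fun y hy w hw h =>
      hr (κ y) (le_antisymm (hκ y w hw) (by rw [h]; exact hκ w y hy))
    have himg : (insert x D).image κ = Finset.univ := by
      rw [← Finset.card_eq_iff_eq_univ, Finset.card_image_of_injOn hκinj,
        Finset.card_insert_of_notMem hxD, hcard]
    have habove : ∀ i, i ≠ κ x → r i (m i) < r i x := by
      intro i hi
      obtain ⟨y, hy, rfl⟩ := Finset.mem_image.1 (himg ▸ Finset.mem_univ i)
      rcases Finset.mem_insert.1 hy with rfl | hyD
      · exact absurd rfl hi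
      · have := hsurj y hyD (κ y) fun w hw => hκ y w (Finset.mem_insert_of_mem hw)
        rw [← this]
        refine lt_of_le_of_ne (hκ y x (Finset.mem_insert_self _ _)) fun h => hxD ?_
        rw [← hr _ h]
        exact hyD
    have htop : IsTopAbove r m (κ x) x := by
      refine ⟨habove, fun y hy => ?_⟩
      have h1 : κ y = κ x := by
        by_contra h
        exact absurd (hκ y _ (Finset.mem_insert_of_mem (hm _))) (not_le.2 (hy _ h))
      rw [← h1]
      exact hκ y x (Finset.mem_insert_self _ _)
    -- Otherwise `m` would take the same value at `κ x` and at the different index `κ (m (κ x))`,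
    -- but `a`, `b` is the only collision.
    have hk : κ x = a ∨ κ x = b := by
      by_contra! h
      have hxm : r (κ x) x < r (κ x) (m (κ x)) := by
        refine lt_of_le_of_ne (hκ x _ (Finset.mem_insert_of_mem (hm _))) fun h => hxD ?_
        rw [hr _ h]
        exact hm _
      have hne : m (κ x) ∈ insert x D := Finset.mem_insert_of_mem (hm _)
      have h2 : κ (m (κ x)) ≠ κ x := fun h' => by
        have := hκinj hne (Finset.mem_insert_self _ _) h'
        exact hxD (this ▸ hm _)
      have h3 := hsurj _ (hm (κ x)) (κ (m (κ x)))
        fun w hw => hκ _ w (Finset.mem_insert_of_mem hw)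
      rcases eq_or_ne (κ (m (κ x))) a with h4 | h4
      · exact h2 (hib (by simp [h4, hab]) (by simp [h.2]) h3.symm)
      · exact h2 (hia (by simp [h4]) (by simp [h.1]) h3.symm)
    rcases hk with hk | hk
    · exact Or.inl (hk ▸ htop)
    · exact Or.inr (hk ▸ htop)
  · rintro (h | h)
    · exact key a (Or.inl rfl) x h
    · exact key b (Or.inr rfl) x h

/-- A map between finite sets of equal size that is not onto: the number of points whose removal
leaves the image equal to the complement of `i₀` is even. -/
theorem even_card_filter_image_erase {I P : Type*} [Fintype I] [DecidableEq I] [DecidableEq P]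
    (c : P → I) (i₀ : I) {S : Finset P} (hcard : S.card = Fintype.card I)
    (hS : S.image c ≠ Finset.univ) :
    Even (S.filter fun x => (S.erase x).image c = Finset.univ.erase i₀).card := by
  by_cases hex : ∃ x ∈ S, (S.erase x).image c = Finset.univ.erase i₀
  swap
  · rw [Finset.filter_eq_empty_iff.2 (by push Not at hex; exact hex)]
    simp
  obtain ⟨x, hx, hximg⟩ := hex
  have hcx : c x ≠ i₀ := by
    intro h
    apply hS
    rw [← Finset.insert_erase hx, Finset.image_insert, hximg, h]
    simp
  have hinj : Set.InjOn c (S.erase x : Finset P) := by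
    rw [← Finset.card_image_iff, hximg, Finset.card_erase_of_mem hx,
      Finset.card_erase_of_mem (Finset.mem_univ _), Finset.card_univ, hcard]
  have hmem : c x ∈ (S.erase x).image c := by rw [hximg]; simp [hcx]
  obtain ⟨y, hy, hyx⟩ := Finset.mem_image.1 hmem
  have hyx' := Finset.mem_erase.1 hy
  -- Besides `x`, only the one other point with the colour of `x` can be removed.
  have : (S.filter fun x => (S.erase x).image c = Finset.univ.erase i₀) = {x, y} := by
    ext w
    simp only [Finset.mem_filter, Finset.mem_insert, Finset.mem_singleton]
    constructor
    · rintro ⟨hw, hwimg⟩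
      by_contra! h
      have hcw : c w ∈ (S.erase w).image c := by
        rw [hwimg, ← hximg]
        exact Finset.mem_image_of_mem c (Finset.mem_erase.2 ⟨h.1, hw⟩)
      obtain ⟨w', hw', hww⟩ := Finset.mem_image.1 hcw
      have hw'' := Finset.mem_erase.1 hw'
      by_cases hw'x : w' = x
      · subst hw'x
        exact h.2 (hinj (Finset.mem_erase.2 ⟨h.1, hw⟩) hy (hww.symm.trans hyx.symm))
      · exact hw''.1 (hinj (Finset.mem_erase.2 ⟨hw'x, hw''.2⟩) (Finset.mem_erase.2 ⟨h.1, hw⟩) hww)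
    · rintro (rfl | rfl)
      · exact ⟨hx, hximg⟩
      · refine ⟨hyx'.2, ?_⟩
        rw [← hximg]
        ext j
        simp only [Finset.mem_image, Finset.mem_erase]
        constructor
        · rintro ⟨v, ⟨hv1, hv2⟩, rfl⟩
          by_cases hvx : v = x
          · exact ⟨w, hyx', by rw [hvx, hyx]⟩
          · exact ⟨v, ⟨hvx, hv2⟩, rfl⟩
        · rintro ⟨v, ⟨hv1, hv2⟩, rfl⟩
          by_cases hvw : v = w
          · exact ⟨x, ⟨hyx'.1.symm, hx⟩, by rw [hvw, hyx]⟩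
          · exact ⟨v, ⟨hvw, hv2⟩, rfl⟩
  rw [this, Finset.card_pair hyx'.1.symm]
  exact even_two

open Classical in
/-- Parity argument: if exactly one dominant set with colours `I \ {i₀}` can be completed to a
dominant set in a unique way and all others in exactly two ways, a dominant set of all colours
exists. -/
theorem exists_isDominant_image_eq_univ {I P : Type*} [Fintype I] [Fintype P]
    [DecidableEq I] [DecidableEq P]
    {r : I → P → ℕ} (hr : ∀ i, Function.Injective (r i)) (c : P → I) (i₀ : I) (B : Finset P)
    (hBcard : B.card + 1 = Fintype.card I) (hBimg : B.image c = Finset.univ.erase i₀)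
    (hB : ∃! x, x ∉ B ∧ IsDominant r (insert x B))
    (hD : ∀ D : Finset P, D.image c = Finset.univ.erase i₀ → D.card + 1 = Fintype.card I →
      D ≠ B → D.Nonempty ∧ ∀ m : I → P, (∀ i, m i ∈ D) →
        (∀ i, ∀ x ∈ D, r i (m i) ≤ r i x) → ∀ k, ∃ y, ∀ i, i ≠ k → r i (m i) < r i y) :
    ∃ S : Finset P, IsDominant r S ∧ S.image c = Finset.univ := by
  by_contra hno
  push Not at hno
  -- Double counting of pairs (D, x). Grouped by `insert x D`, every fibre is even if no dominant
  -- set has all colours; grouped by D, only `B` has an odd fibre: 1, against 0 or 2.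
  set F : Finset (Finset P × P) := Finset.univ.filter fun q =>
    (q.1.image c = Finset.univ.erase i₀ ∧ q.1.card + 1 = Fintype.card I) ∧
      q.2 ∉ q.1 ∧ IsDominant r (insert q.2 q.1) with hF
  have h1 : Even F.card := by
    rw [Finset.card_eq_sum_card_fiberwise (f := fun q => insert q.2 q.1) (t := Finset.univ)
      (fun _ _ => Finset.mem_univ _)]
    refine Finset.even_sum _ fun S _ => ?_
    by_cases hS : IsDominant r S ∧ S.card = Fintype.card I
    · suffices hc : (F.filter fun q => insert q.2 q.1 = S).card =
          (S.filter fun x => (S.erase x).image c = Finset.univ.erase i₀).card by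
        rw [hc]
        exact even_card_filter_image_erase c i₀ hS.2 (hno S hS.1)
      refine Finset.card_bij' (fun q _ => q.2) (fun x _ => (S.erase x, x)) ?_ ?_ ?_ ?_
      · rintro ⟨D, x⟩ hq
        simp only [hF, Finset.mem_filter, Finset.mem_univ, true_and] at hq
        obtain ⟨⟨⟨h1, h2⟩, h3, h4⟩, rfl⟩ := hq
        simp [Finset.erase_insert h3, h1]
      · intro x hx
        obtain ⟨hx, hximg⟩ := Finset.mem_filter.1 hx
        simp only [hF, Finset.mem_filter, Finset.mem_univ, true_and, Finset.insert_erase hx]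
        refine ⟨⟨⟨hximg, ?_⟩, by simp, hS.1⟩, trivial⟩
        rw [Finset.card_erase_add_one hx, hS.2]
      · rintro ⟨D, x⟩ hq
        simp only [hF, Finset.mem_filter, Finset.mem_univ, true_and] at hq
        obtain ⟨⟨⟨h1, h2⟩, h3, h4⟩, rfl⟩ := hq
        simp [Finset.erase_insert h3]
      · intro x hx
        rfl
    · rw [Finset.card_eq_zero.2]
      · simp
      · refine Finset.filter_eq_empty_iff.2 ?_
        rintro ⟨D, x⟩ hq rfl
        simp only [hF, Finset.mem_filter, Finset.mem_univ, true_and] at hq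
        exact hS ⟨hq.2.2, by rw [Finset.card_insert_of_notMem hq.2.1, hq.1.2]⟩
  have hfib : ∀ D : Finset P, D.image c = Finset.univ.erase i₀ ∧ D.card + 1 = Fintype.card I →
      (F.filter fun q => q.1 = D).card =
        (Finset.univ.filter fun x => x ∉ D ∧ IsDominant r (insert x D)).card := by
    intro D hD
    refine Finset.card_bij' (fun q _ => q.2) (fun x _ => (D, x)) ?_ ?_ ?_ ?_
    · rintro ⟨D', x⟩ hq
      simp only [hF, Finset.mem_filter, Finset.mem_univ, true_and] at hq ⊢
      obtain ⟨⟨h1, h3⟩, rfl⟩ := hq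
      exact h3
    · intro x hx
      simp only [hF, Finset.mem_filter, Finset.mem_univ, true_and] at hx ⊢
      exact ⟨⟨hD, hx⟩, trivial⟩
    · rintro ⟨D', x⟩ hq
      simp only [Finset.mem_filter] at hq
      simp [hq.2]
    · intro x hx
      rfl
  have h2 : ¬ Even F.card := by
    rw [Finset.card_eq_sum_card_fiberwise (f := Prod.fst) (t := Finset.univ)
      (fun _ _ => Finset.mem_univ _), ← Finset.add_sum_erase _ _ (Finset.mem_univ B),
      Nat.even_add, _root_.not_iff]
    have hB1 : (F.filter fun q => q.1 = B).card = 1 := by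
      rw [hfib B ⟨hBimg, hBcard⟩, Finset.card_eq_one]
      obtain ⟨x, hx, huniq⟩ := hB
      refine ⟨x, ?_⟩
      ext w
      simp only [Finset.mem_filter, Finset.mem_univ, true_and, Finset.mem_singleton]
      exact ⟨huniq w, fun h => h ▸ hx⟩
    rw [hB1]
    refine iff_of_true (by decide) (Finset.even_sum _ fun D hDB => ?_)
    by_cases hDD : D.image c = Finset.univ.erase i₀ ∧ D.card + 1 = Fintype.card I
    · rw [hfib D hDD]
      by_cases hdom : IsDominant r D
      · obtain ⟨hne, hY⟩ := hD D hDD.1 hDD.2 (Finset.ne_of_mem_erase hDB)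
        obtain ⟨m, a, b, hm, hmin, hdisj, hiff⟩ := hdom.exists_insert_iff hr hne hDD.2
        obtain ⟨y, hy⟩ := hY m hm hmin a
        obtain ⟨y', hy'⟩ := hY m hm hmin b
        obtain ⟨p, hp, hpu⟩ := existsUnique_isTopAbove hr hy
        obtain ⟨q, hq, hqu⟩ := existsUnique_isTopAbove hr hy'
        have : (Finset.univ.filter fun x => x ∉ D ∧ IsDominant r (insert x D)) = {p, q} := by
          ext w
          simp only [hiff, Finset.mem_filter, Finset.mem_univ, true_and, Finset.mem_insert,
            Finset.mem_singleton]
          exact ⟨Or.imp (hpu w) (hqu w), Or.imp (fun h => h ▸ hp) (fun h => h ▸ hq)⟩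
        rw [this, Finset.card_pair]
        · exact even_two
        · rintro rfl
          exact hdisj _ ⟨hp, hq⟩
      · rw [Finset.card_eq_zero.2]
        · simp
        · exact Finset.filter_eq_empty_iff.2 fun x _ hx =>
            hdom (hx.2.mono (Finset.subset_insert _ _))
    · rw [Finset.card_eq_zero.2]
      · simp
      · refine Finset.filter_eq_empty_iff.2 ?_
        rintro ⟨D', x⟩ hq rfl
        simp only [hF, Finset.mem_filter, Finset.mem_univ, true_and] at hq
        exact hDD hq.1
  exact h2 h1

/-- Scarf's lemma: for finitely many injective rankings of a finite set coloured by the indices,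
there is a set of indices `C` and a set `σ` dominant for the rankings in `C` which contains all
colours of `C`. -/
theorem exists_dominant_colorful {I T : Type*} [Fintype I] [Nonempty I] [Fintype T] [Nonempty T]
    {ρ : I → T → ℕ} (hρ : ∀ i, Function.Injective (ρ i)) (c : T → I) :
    ∃ (C : Finset I) (σ : Finset T), (∀ i ∈ C, ∃ x ∈ σ, c x = i) ∧
      ∀ y, ∃ i ∈ C, ∀ x ∈ σ, ρ i y ≤ ρ i x := by
  classical
  obtain ⟨i₀⟩ := ‹Nonempty I›
  obtain ⟨M, hM⟩ : ∃ M, ∀ i t, ρ i t + 1 < M := by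
    refine ⟨∑ i, ∑ t, ρ i t + 2, fun i t => ?_⟩
    have h1 : ρ i t ≤ ∑ t, ρ i t :=
      Finset.single_le_sum (fun _ _ => Nat.zero_le _) (Finset.mem_univ t)
    have h2 : ∑ t, ρ i t ≤ ∑ i, ∑ t, ρ i t :=
      Finset.single_le_sum (f := fun i => ∑ t, ρ i t) (fun _ _ => Nat.zero_le _)
        (Finset.mem_univ i)
    omega
  let e : I → ℕ := fun i => (Fintype.equivFin I i : ℕ)
  have he : Function.Injective e := Fin.val_injective.comp (Fintype.equivFin I).injective
  -- One slack element per index: lowest in its own ranking, above all of `T` in the others. The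
  -- shift by 1 and the term `e j` keep the rankings injective.
  let r : I → T ⊕ I → ℕ := fun i =>
    Sum.elim (fun t => ρ i t + 1) (fun j => if j = i then 0 else M + e j)
  have hrl : ∀ i t, r i (Sum.inl t) = ρ i t + 1 := fun _ _ => rfl
  have hrs : ∀ i, r i (Sum.inr i) = 0 := fun i => if_pos rfl
  have hrr : ∀ i j, j ≠ i → r i (Sum.inr j) = M + e j := fun i j h => if_neg h
  have hr : ∀ i, Function.Injective (r i) := by
    rintro i (t | j) (t' | j') h
    · rw [hrl, hrl] at h
      rw [hρ i (Nat.succ_injective h)]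
    · rw [hrl] at h
      have := hM i t
      by_cases hj : j' = i
      · rw [hj, hrs] at h; omega
      · rw [hrr _ _ hj] at h; omega
    · rw [hrl] at h
      have := hM i t'
      by_cases hj : j = i
      · rw [hj, hrs] at h; omega
      · rw [hrr _ _ hj] at h; omega
    · have hMi := hM i (Classical.arbitrary T)
      by_cases hj : j = i <;> by_cases hj' : j' = i
      · rw [hj, hj']
      · rw [hj, hrs, hrr _ _ hj'] at h; omega
      · rw [hj', hrs, hrr _ _ hj] at h; omega
      · rw [hrr _ _ hj', hrr _ _ hj] at h
        rw [he (Nat.add_left_cancel h)]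
  let c' : T ⊕ I → I := Sum.elim c id
  let B : Finset (T ⊕ I) := (Finset.univ.erase i₀).map Function.Embedding.inr
  have hBmem : ∀ j, Sum.inr j ∈ B ↔ j ≠ i₀ := by simp [B]
  obtain ⟨S, hS, hSimg⟩ : ∃ S : Finset (T ⊕ I), IsDominant r S ∧ S.image c' = Finset.univ := by
    refine exists_isDominant_image_eq_univ hr c' i₀ B ?_ ?_ ?_ ?_
    · rw [Finset.card_map, Finset.card_erase_add_one (Finset.mem_univ _), Finset.card_univ]
    · ext j
      simp [B, c']
    · obtain ⟨t, ht⟩ := Finite.exists_max (ρ i₀)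
      refine ⟨Sum.inl t, ⟨by simp [B], ?_⟩, ?_⟩
      · rintro (s | j)
        · refine ⟨i₀, fun x hx => ?_⟩
          rcases Finset.mem_insert.1 hx with rfl | hx
          · exact Nat.succ_le_succ (ht s)
          · obtain ⟨j, hj, rfl⟩ := Finset.mem_map.1 hx
            have := hM i₀ s
            simp only [Function.Embedding.inr_apply, hrl, hrr _ _ (Finset.ne_of_mem_erase hj)]
            omega
        · exact ⟨j, fun x _ => by rw [hrs]; exact Nat.zero_le _⟩
      · rintro (s | j) ⟨hxB, hdom⟩
        · obtain ⟨i, hi⟩ := hdom (Sum.inl t)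
          have hii : i = i₀ := by
            by_contra hne
            have := hi (Sum.inr i) (Finset.mem_insert_of_mem ((hBmem i).2 hne))
            rw [hrs, hrl] at this
            omega
          subst hii
          have := hi _ (Finset.mem_insert_self _ _)
          rw [hrl, hrl] at this
          rw [hρ i (le_antisymm (ht s) (Nat.le_of_succ_le_succ this))]
        · have hj : j = i₀ := by
            by_contra h
            exact hxB ((hBmem j).2 h)
          subst hj
          obtain ⟨i, hi⟩ := hdom (Sum.inl t)
          have := hi (Sum.inr i) (by
            by_cases h : i = j
            · rw [h]; exact Finset.mem_insert_self _ _
            · exact Finset.mem_insert_of_mem ((hBmem i).2 h))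
          rw [hrs, hrl] at this
          omega
    · intro D himg hcard hDB
      -- `B` is the only set of slacks with these colours. A genuine element in `D` keeps every
      -- threshold below `M`, so the slack of `k` beats all thresholds other than that of `k`.
      have hex : ∃ t, Sum.inl t ∈ D := by
        by_contra! h
        apply hDB
        ext (t | j)
        · simp [B, h t]
        · rw [hBmem]
          have : j ∈ D.image c' ↔ j ≠ i₀ := by rw [himg]; simp
          rw [← this, Finset.mem_image]
          constructor
          · exact fun hj => ⟨_, hj, rfl⟩
          · rintro ⟨(t | j'), hj, h'⟩
            · exact absurd hj (h t)
            · have : j' = j := h'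
              exact this ▸ hj
      obtain ⟨t, ht⟩ := hex
      refine ⟨⟨_, ht⟩, fun m hm hmin k => ⟨Sum.inr k, fun i hi => ?_⟩⟩
      have h1 := hmin i _ ht
      have h2 := hM i t
      rw [hrl] at h1
      rw [hrr _ _ hi.symm]
      omega
  refine ⟨Finset.univ.filter fun i => Sum.inr i ∉ S, Finset.univ.filter fun t => Sum.inl t ∈ S,
    fun i hi => ?_, fun y => ?_⟩
  · have hiS := (Finset.mem_filter.1 hi).2
    obtain ⟨(x | j), hx, hxi⟩ := Finset.mem_image.1 (hSimg ▸ Finset.mem_univ i)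
    · exact ⟨x, by simpa using hx, hxi⟩
    · have : j = i := hxi
      exact absurd (this ▸ hx) hiS
  · obtain ⟨i, hi⟩ := hS (Sum.inl y)
    refine ⟨i, ?_, fun x hx => ?_⟩
    · simp only [Finset.mem_filter, Finset.mem_univ, true_and]
      intro h
      have := hi _ h
      rw [hrs, hrl] at this
      omega
    · have := hi (Sum.inl x) (by simpa using hx)
      rw [hrl, hrl] at this
      omega

/-! ### The KKM lemma on the simplex -/

/-- Scarf's lemma for the coordinate rankings: domination forces the members of `σ` to be close to
each other and to have small coordinates outside `C`, while `σ` carries every colour in `C`. -/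
theorem exists_grid_point_near_colors {I : Type*} [Fintype I] [Nonempty I] (N : ℕ)
    (A : I → (I → ℕ) → Prop) (hA : ∀ p, ∑ i, p i = N → ∃ i, A i p) :
    ∃ p : I → ℕ, ∑ i, p i = N ∧ ∀ i, p i ≤ Fintype.card I ∨
      ∃ q, ∑ i, q i = N ∧ A i q ∧
        ∀ j, q j ≤ p j + Fintype.card I ∧ p j ≤ q j + Fintype.card I := by
  classical
  let G : Finset (I → ℕ) := Finset.piAntidiag Finset.univ N
  have hG : ∀ p, p ∈ G ↔ ∑ i, p i = N := fun p => by simp [G, Finset.mem_piAntidiag]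
  have hGne : Nonempty G :=
    ⟨⟨Pi.single (Classical.arbitrary I) N, (hG _).2 (by simp)⟩⟩
  let e : G → ℕ := fun t => (Fintype.equivFin G t : ℕ)
  have he : Function.Injective e := Fin.val_injective.comp (Fintype.equivFin G).injective
  set M := Fintype.card G with hM
  have heM : ∀ t, e t < M := fun t => (Fintype.equivFin G t).2
  -- Order by the `i`-th coordinate, ties broken by an enumeration with values below `M`.
  let ρ : I → G → ℕ := fun i t => t.1 i * M + e t
  have hlt : ∀ i s t, s.1 i < t.1 i → ρ i s < ρ i t := by
    intro i s t h
    have h1 := heM s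
    have h2 : (s.1 i + 1) * M ≤ t.1 i * M := Nat.mul_le_mul_right _ h
    simp only [ρ]
    nlinarith
  have hρ : ∀ i, Function.Injective (ρ i) := by
    intro i s t h
    rcases lt_trichotomy (s.1 i) (t.1 i) with h' | h' | h'
    · exact absurd h (hlt i s t h').ne
    · simp only [ρ, h'] at h
      exact he (Nat.add_left_cancel h)
    · exact absurd h (hlt i t s h').ne'
  choose c hc using fun t : G => hA t.1 ((hG _).1 t.2)
  obtain ⟨C, σ, hCσ, hdom⟩ := exists_dominant_colorful hρ c
  obtain ⟨i₁, hi₁, -⟩ := hdom (Classical.arbitrary G)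
  obtain ⟨p, hp, -⟩ := hCσ i₁ hi₁
  choose m hmσ hm using fun i => σ.exists_min_image (fun t => t.1 i) ⟨p, hp⟩
  have hsum : N < ∑ i ∈ C, (m i).1 i + C.card := by
    by_contra! h
    -- A grid point exceeding the minimum over `σ` in every coordinate of `C`, hence not dominated;
    -- the surplus goes to `i₁ ∈ C`.
    let y : I → ℕ := (fun i => if i ∈ C then (m i).1 i + 1 else 0) +
      Pi.single i₁ (N - (∑ i ∈ C, (m i).1 i + C.card))
    have hy : ∑ i, y i = N := by
      have : ∑ i ∈ C, ((m i).1 i + 1) = ∑ i ∈ C, (m i).1 i + C.card := by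
        rw [Finset.sum_add_distrib, Finset.card_eq_sum_ones]
      simp only [y, Pi.add_apply, Finset.sum_add_distrib, Finset.sum_ite_mem, Finset.univ_inter,
        Finset.sum_pi_single', Finset.mem_univ, if_true] at this ⊢
      simp
      simp at this
      omega
    obtain ⟨i, hiC, hi⟩ := hdom ⟨y, (hG _).2 hy⟩
    refine absurd (hi _ (hmσ i)) (not_le.2 (hlt _ _ _ ?_))
    simp only [y, Pi.add_apply, if_pos hiC]
    omega
  have hCcard : C.card ≤ Fintype.card I := Finset.card_le_univ _
  have hmsum : ∀ x ∈ σ, ∀ D : Finset I, ∑ i ∈ D, (m i).1 i ≤ ∑ i ∈ D, x.1 i :=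
    fun x hx D => Finset.sum_le_sum fun i _ => hm i x hx
  have hub : ∀ x : G, ∀ D : Finset I, ∑ i ∈ D, x.1 i ≤ N := fun x D =>
    (Finset.sum_le_sum_of_subset (Finset.subset_univ D)).trans ((hG _).1 x.2).le
  have hin : ∀ x ∈ σ, ∀ j ∈ C, x.1 j ≤ (m j).1 j + Fintype.card I := by
    intro x hx j hj
    have h1 := Finset.add_sum_erase C (fun i => x.1 i) hj
    have h2 := Finset.add_sum_erase C (fun i => (m i).1 i) hj
    have h3 := hmsum x hx (C.erase j)
    have h4 := hub x C
    omega
  have hout : ∀ x ∈ σ, ∀ j ∉ C, x.1 j ≤ Fintype.card I := by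
    intro x hx j hj
    have h1 := Finset.sum_insert (f := fun i => x.1 i) hj
    have h3 := hmsum x hx C
    have h4 := hub x (insert j C)
    omega
  have hnear : ∀ x ∈ σ, ∀ x' ∈ σ, ∀ j, x.1 j ≤ x'.1 j + Fintype.card I := by
    intro x hx x' hx' j
    by_cases hj : j ∈ C
    · have h1 := hin x hx j hj
      have h2 := hm j x' hx'
      omega
    · have h1 := hout x hx j hj
      omega
  refine ⟨p.1, (hG _).1 p.2, fun i => ?_⟩
  by_cases hi : i ∈ C
  · obtain ⟨x, hx, rfl⟩ := hCσ i hi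
    exact Or.inr ⟨x.1, (hG _).1 x.2, hc x, fun j => ⟨hnear x hx p hp j, hnear p hp x hx j⟩⟩
  · exact Or.inl (hout p hp i hi)

/-- If closed sets `A i` cover the standard simplex, some point of the simplex lies in `A i` for
every `i` in its support. -/
theorem exists_mem_stdSimplex_forall_eq_zero_or_mem {I : Type*} [Fintype I] [Nonempty I]
    (A : I → Set (I → ℝ)) (hclosed : ∀ i, IsClosed (A i))
    (hcover : ∀ x ∈ stdSimplex ℝ I, ∃ i, x ∈ A i) :
    ∃ x ∈ stdSimplex ℝ I, ∀ i, x i = 0 ∨ x ∈ A i := by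
  let s : ℕ → (I → ℕ) → I → ℝ := fun N p i => (p i : ℝ) / (N + 1)
  have hs : ∀ N p, ∑ i, p i = N + 1 → s N p ∈ stdSimplex ℝ I := by
    intro N p hp
    refine ⟨fun i => by positivity, ?_⟩
    simp only [s]
    rw [← Finset.sum_div, div_eq_one_iff_eq (by positivity)]
    exact_mod_cast hp
  choose p hp hpA using fun N : ℕ => exists_grid_point_near_colors (I := I) (N + 1)
    (fun i p => s N p ∈ A i) (fun p hp => hcover _ (hs N p hp))
  set n : ℝ := (Fintype.card I : ℝ) with hn
  obtain ⟨x, hx, φ, hφ, hlim⟩ := (isCompact_stdSimplex ℝ I).tendsto_subseq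
    (fun N => hs N (p N) (hp N))
  have hsmall : Tendsto (fun k => n / ((φ k : ℝ) + 1)) atTop (𝓝 0) :=
    ((tendsto_const_nhds.div_atTop
      (tendsto_atTop_add_const_right _ 1 tendsto_natCast_atTop_atTop) :
      Tendsto (fun N : ℕ => n / ((N : ℝ) + 1)) atTop (𝓝 0))).comp hφ.tendsto_atTop
  refine ⟨x, hx, fun i => or_iff_not_imp_left.2 fun hxi => ?_⟩
  have hxi : 0 < x i := lt_of_le_of_ne (hx.1 i) (Ne.symm hxi)
  have hlimi : Tendsto (fun k => s (φ k) (p (φ k)) i) atTop (𝓝 (x i)) :=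
    (tendsto_pi_nhds.1 hlim) i
  have hev : ∀ᶠ k in atTop, n / ((φ k : ℝ) + 1) < s (φ k) (p (φ k)) i :=
    hsmall.eventually_lt hlimi hxi
  rw [← (hclosed i).closure_eq, Metric.mem_closure_iff]
  intro ε hε
  have hd1 : ∀ᶠ k in atTop, dist (s (φ k) (p (φ k))) x < ε / 2 :=
    (Metric.tendsto_nhds.1 hlim) _ (half_pos hε)
  have hd2 : ∀ᶠ k in atTop, n / ((φ k : ℝ) + 1) < ε / 2 :=
    hsmall.eventually (gt_mem_nhds (half_pos hε))
  obtain ⟨k, hk, hk1, hk2⟩ := (hev.and (hd1.and hd2)).exists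
  have hpos : (0 : ℝ) < (φ k : ℝ) + 1 := by positivity
  rcases hpA (φ k) i with h | ⟨q, -, hqA, hq⟩
  · rw [div_lt_div_iff_of_pos_right hpos] at hk
    exact absurd hk (not_lt.2 (by rw [hn]; exact_mod_cast h))
  · refine ⟨_, hqA, ?_⟩
    have hdist : dist (s (φ k) (p (φ k))) (s (φ k) q) ≤ n / ((φ k : ℝ) + 1) := by
      refine (dist_pi_le_iff (by positivity)).2 fun j => ?_
      simp only [s]
      rw [Real.dist_eq, ← sub_div, abs_div, abs_of_pos hpos]
      gcongr
      obtain ⟨h1, h2⟩ := hq j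
      rw [abs_le, hn]
      constructor
      · have : (q j : ℝ) ≤ p (φ k) j + Fintype.card I := by exact_mod_cast h1
        linarith
      · have : (p (φ k) j : ℝ) ≤ q j + Fintype.card I := by exact_mod_cast h2
        linarith
    calc dist x (s (φ k) q) ≤ dist x (s (φ k) (p (φ k))) + dist (s (φ k) (p (φ k))) (s (φ k) q) :=
          dist_triangle _ _ _
      _ < ε / 2 + ε / 2 := by
          rw [dist_comm x]
          exact add_lt_add hk1 (hdist.trans_lt hk2)
      _ = ε := add_halves ε

/-- The Knaster–Kuratowski–Mazurkiewicz lemma on the standard simplex. -/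
theorem stdSimplex_kkm {I : Type*} [Fintype I] [Nonempty I]
    (A : I → Set (I → ℝ)) (hclosed : ∀ i, IsClosed (A i))
    (hcover : ∀ x ∈ stdSimplex ℝ I, ∃ i, x i ≠ 0 ∧ x ∈ A i) :
    ∃ x ∈ stdSimplex ℝ I, ∀ i, x ∈ A i := by
  classical
  have hne : ∀ i, (A i).Nonempty := by
    intro i
    obtain ⟨j, hj, hjA⟩ := hcover _ (single_mem_stdSimplex ℝ i)
    have : j = i := by
      by_contra h
      exact hj (by simp [h])
    exact ⟨_, this ▸ hjA⟩
  let d : I → (I → ℝ) → ℝ := fun i x => Metric.infDist x (A i)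
  have hd : ∀ i, Continuous (d i) := fun i => Metric.continuous_infDist_pt _
  have hd0 : ∀ i x, 0 ≤ d i x := fun i x => Metric.infDist_nonneg
  have hmem : ∀ i x, x ∈ A i ↔ d i x = 0 := fun i x => (hclosed i).mem_iff_infDist_zero (hne i)
  -- These sets cover the simplex since the weights x_i sum to 1. At the point found, some `i` in
  -- the support has `d i x = 0`, which forces the total distance to vanish.
  obtain ⟨x, hx, hxB⟩ := exists_mem_stdSimplex_forall_eq_zero_or_mem
    (fun i => {x | x i * ∑ j, d j x ≤ d i x})
    (fun i => isClosed_le ((continuous_apply i).mul (continuous_finsetSum _ fun j _ => hd j))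
      (hd i))
    (fun x hx => by
      by_contra! h
      have : ∑ i, d i x < ∑ i, x i * ∑ j, d j x :=
        Finset.sum_lt_sum_of_nonempty Finset.univ_nonempty fun i _ => by simpa using h i
      rw [← Finset.sum_mul, hx.2, one_mul] at this
      exact lt_irrefl _ this)
  refine ⟨x, hx, ?_⟩
  obtain ⟨i, hi, hiA⟩ := hcover x hx
  have hsum : ∑ j, d j x = 0 := by
    have h1 : x i * ∑ j, d j x ≤ d i x := (hxB i).resolve_left hi
    rw [(hmem i x).1 hiA] at h1
    have h2 : 0 < x i := lt_of_le_of_ne (hx.1 i) (Ne.symm hi)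
    refine le_antisymm ?_ (Finset.sum_nonneg fun j _ => hd0 j x)
    by_contra! h
    exact absurd h1 (not_le.2 (mul_pos h2 h))
  intro j
  rw [hmem]
  exact (Finset.sum_eq_zero_iff_of_nonneg fun j _ => hd0 j x).1 hsum j (Finset.mem_univ j)

/-! ### KKM in topological vector spaces -/

/-- The Knaster–Kuratowski–Mazurkiewicz principle on a compact convex set. -/
theorem IsCompact.kkm {X : Type*} [AddCommGroup X] [Module ℝ X] [TopologicalSpace X]
    [IsTopologicalAddGroup X] [ContinuousSMul ℝ X] [T2Space X]
    {K : Set X} (hK : IsCompact K) (hconv : Convex ℝ K) (hne : K.Nonempty) (G : X → Set X)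
    (hG : ∀ y ∈ K, IsClosed (G y))
    (hkkm : ∀ (n : ℕ) (y : Fin n → X) (l : Fin n → ℝ), (∀ i, y i ∈ K) → (∀ i, 0 ≤ l i) →
      ∑ i, l i = 1 → ∃ i, l i ≠ 0 ∧ ∑ j, l j • y j ∈ G (y i)) :
    ∃ x ∈ K, ∀ y ∈ K, x ∈ G y := by
  have hfin : (K ∩ ⋂ y : K, G y).Nonempty := by
    refine hK.inter_iInter_nonempty _ (fun y => hG y y.2) fun u => ?_
    rcases u.eq_empty_or_nonempty with rfl | hu
    · simpa using hne
    let y : Fin u.card → X := fun i => (u.equivFin.symm i : K)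
    have hy : ∀ i, y i ∈ K := fun i => Subtype.coe_prop _
    have : Nonempty (Fin u.card) := Fin.pos_iff_nonempty.1 hu.card_pos
    have hcont : Continuous fun l : Fin u.card → ℝ => ∑ j, l j • y j :=
      continuous_finsetSum _ fun j _ => (continuous_apply j).smul continuous_const
    obtain ⟨l, hl, hlG⟩ := stdSimplex_kkm (fun i => {l | ∑ j, l j • y j ∈ G (y i)})
      (fun i => (hG _ (hy i)).preimage hcont) (fun l hl => hkkm _ y l hy hl.1 hl.2)
    refine ⟨∑ j, l j • y j, hconv.sum_mem (fun i _ => hl.1 i) hl.2 fun i _ => hy i, ?_⟩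
    simp only [mem_iInter]
    intro z hz
    simpa [y] using hlG (u.equivFin ⟨z, hz⟩)
  obtain ⟨x, hx, hxG⟩ := hfin
  exact ⟨x, hx, fun y hy => mem_iInter.1 hxG ⟨y, hy⟩⟩

/-! ### Cones, cone-convex maps and the net condition -/

theorem PointedCone.add_mem_interior {Z : Type*} [AddCommGroup Z] [Module ℝ Z]
    [TopologicalSpace Z] [IsTopologicalAddGroup Z] (C : PointedCone ℝ Z) {c z : Z}
    (hc : c ∈ C) (hz : z ∈ interior (C : Set Z)) : c + z ∈ interior (C : Set Z) := by
  have hsub : (C : Set Z) + interior (C : Set Z) ⊆ C := by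
    rintro _ ⟨a, ha, b, hb, rfl⟩
    exact C.add_mem ha (interior_subset hb)
  exact interior_maximal hsub isOpen_interior.add_left (Set.add_mem_add hc hz)

theorem PointedCone.convex_coe {Z : Type*} [AddCommGroup Z] [Module ℝ Z]
    (C : PointedCone ℝ Z) : Convex ℝ (C : Set Z) := fun _ hx _ hy _ _ ha hb _ =>
  C.add_mem (C.smul_mem ha hx)
    (C.smul_mem hb hy)

/-- The interior of a cone is stable under positive dilations. -/
theorem PointedCone.smul_mem_interior {Z : Type*} [AddCommGroup Z] [Module ℝ Z]
    [TopologicalSpace Z] [ContinuousSMul ℝ Z] (C : PointedCone ℝ Z) {t : ℝ} (ht : 0 < t) {z : Z}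
    (hz : z ∈ interior (C : Set Z)) : t • z ∈ interior (C : Set Z) := by
  have hsub : t • interior (C : Set Z) ⊆ C := by
    rintro _ ⟨a, ha, rfl⟩
    exact C.smul_mem ht.le (interior_subset ha)
  exact interior_maximal hsub (isOpen_interior.smul₀ ht.ne') (Set.smul_mem_smul_set hz)

/-- Jensen's inequality for cone-convex maps. -/
theorem CConvexOn.sum_smul_sub_mem {X Z ι : Type*} [AddCommGroup X] [Module ℝ X]
    [AddCommGroup Z] [Module ℝ Z] {C : PointedCone ℝ Z} {K : Set X} (hK : Convex ℝ K)
    {φ : X → Z} (hφ : CConvexOn (C : Set Z) K φ) {s : Finset ι} {l : ι → ℝ} {y : ι → X}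
    (hl : ∀ i ∈ s, 0 ≤ l i) (hl1 : ∑ i ∈ s, l i = 1) (hy : ∀ i ∈ s, y i ∈ K) :
    ∑ i ∈ s, l i • φ (y i) - φ (∑ i ∈ s, l i • y i) ∈ C := by
  -- Jensen's inequality is the convexity of the epigraph.
  have hepi : Convex ℝ {p : X × Z | p.1 ∈ K ∧ p.2 - φ p.1 ∈ C} := by
    rintro ⟨x, z⟩ ⟨hx, hz⟩ ⟨x', z'⟩ ⟨hx', hz'⟩ a b ha hb hab
    refine ⟨hK hx hx' ha hb hab, ?_⟩
    obtain rfl : b = 1 - a := by linarith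
    have h1 := hφ x hx x' hx' a ⟨ha, by linarith⟩
    have h2 := C.convex_coe hz hz' ha hb hab
    have h3 := C.add_mem h1 h2
    simp only [Prod.smul_mk, Prod.mk_add_mk] at h3 ⊢
    convert h3 using 1
    module
  have := hepi.sum_mem (z := fun i => (y i, φ (y i))) hl hl1 fun i hi => ⟨hy i hi, by simp⟩
  simpa [Prod.fst_sum, Prod.snd_sum] using this.2

/-- If a cone-convex map takes a value in `-int C` at `v` and a value in `-C` at `u`, it takes
values in `-int C` on `]u, v]`. -/
theorem CConvexOn.mem_neg_interior {X Z : Type*} [AddCommGroup X] [Module ℝ X]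
    [AddCommGroup Z] [Module ℝ Z] [TopologicalSpace Z] [IsTopologicalAddGroup Z]
    [ContinuousSMul ℝ Z] {C : PointedCone ℝ Z} {K : Set X} {φ : X → Z}
    (hφ : CConvexOn (C : Set Z) K φ) {u v : X} (hu : u ∈ K) (hv : v ∈ K)
    (hφu : φ u ∈ -(C : Set Z)) (hφv : φ v ∈ -interior (C : Set Z)) {t : ℝ} (ht : t ∈ Ioc (0 : ℝ) 1) :
    φ (u + t • (v - u)) ∈ -interior (C : Set Z) := by
  have h1 := hφ v hv u hu t ⟨ht.1.le, ht.2⟩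
  have h2 := C.smul_mem_interior ht.1 hφv
  have h3 : (1 - t) • -φ u ∈ C :=
    C.smul_mem (sub_nonneg.2 ht.2) hφu
  have h4 := C.add_mem_interior (C.add_mem h1 h3) h2
  rw [show u + t • (v - u) = t • v + (1 - t) • u by module, Set.mem_neg]
  convert h4 using 1
  module

theorem CConvexOn.add {X Z : Type*} [AddCommGroup X] [Module ℝ X]
    [AddCommGroup Z] [Module ℝ Z] {C : PointedCone ℝ Z} {K : Set X} {φ ψ : X → Z}
    (hφ : CConvexOn (C : Set Z) K φ) (hψ : CConvexOn (C : Set Z) K ψ) :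
    CConvexOn (C : Set Z) K fun x => φ x + ψ x := by
  intro x hx y hy t ht
  have := C.add_mem (hφ x hx y hy t ht) (hψ x hx y hy t ht)
  rw [SetLike.mem_coe]
  convert this using 1
  module

/-- Under the net condition the points where a map avoids `-int C` form a closed set. -/
theorem NetCondition.isClosed {X : Type u} {Z : Type v} [TopologicalSpace X]
    [TopologicalSpace Z] [AddCommGroup Z] [Module ℝ Z] [IsTopologicalAddGroup Z]
    {C : PointedCone ℝ Z} {K : Set X} (hK : IsClosed K) {φ : X → Z}
    (hφ : NetCondition (C : Set Z) K φ) :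
    IsClosed {x | x ∈ K ∧ φ x ∉ -interior (C : Set Z)} := by
  refine isClosed_of_closure_subset fun x hx => ?_
  have hxK : x ∈ K := hK.closure_subset_iff.2 (fun _ h => h.1) hx
  refine ⟨hxK, fun hxC => ?_⟩
  -- The net is indexed by the neighbourhoods of `x` under reverse inclusion, a type in the universe
  -- of `X` as `NetCondition` demands.
  choose w hwU hw using fun U : ((𝓝 x).sets)ᵒᵈ => mem_closure_iff_nhds.1 hx _ (OrderDual.ofDual U).2
  have : IsDirectedOrder ((𝓝 x).sets)ᵒᵈ := ⟨fun U V =>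
    ⟨OrderDual.toDual ⟨_, inter_mem (OrderDual.ofDual U).2 (OrderDual.ofDual V).2⟩,
      inter_subset_left, inter_subset_right⟩⟩
  have hne : Nonempty ((𝓝 x).sets)ᵒᵈ := ⟨OrderDual.toDual ⟨univ, univ_mem⟩⟩
  have hlim : Tendsto w atTop (𝓝 x) := by
    rw [tendsto_def]
    intro U hU
    filter_upwards [mem_atTop (OrderDual.toDual (⟨U, hU⟩ : (𝓝 x).sets))] with V hV
    have hVU : (OrderDual.ofDual V).1 ⊆ U := hV
    exact hVU (hwU V)
  obtain ⟨a, z, haz, ha, hz⟩ := hφ x hxK _ w (fun U => (hw U).1) hlim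
  have hzC : z ∈ -interior (C : Set Z) := by
    rw [Set.mem_neg]
    convert C.add_mem_interior hz hxC using 1
    abel
  obtain ⟨U, hU⟩ := (haz.eventually (isOpen_interior.neg.mem_nhds hzC)).exists
  refine (hw U).2 ?_
  rw [Set.mem_neg]
  convert C.add_mem_interior (ha U) hU using 1
  abel

/-! ### The equilibrium theorem -/

theorem theorem5p4 {X : Type u} {Z : Type v}
    [AddCommGroup X] [Module ℝ X] [TopologicalSpace X] [IsTopologicalAddGroup X]
    [ContinuousSMul ℝ X] [T2Space X]
    [AddCommGroup Z] [Module ℝ Z] [TopologicalSpace Z] [IsTopologicalAddGroup Z]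
    [ContinuousSMul ℝ Z] [T2Space Z]
    (C : PointedCone ℝ Z)
    (hCpointed : (C : Set Z) ∩ -(C : Set Z) = {0})
    (hCint : (interior (C : Set Z)).Nonempty)
    (K : Set X) (hKne : K.Nonempty) (hKconv : Convex ℝ K)
    (f g : X → X → Z)
    (K₀ : Set X) (hK₀K : K₀ ⊆ K) (hK₀ne : K₀.Nonempty) (hK₀comp : IsCompact K₀)
    (hK₀conv : Convex ℝ K₀)
    (hcoercive : ∀ x ∈ K₀ \ relCore K K₀, ∃ y₀ ∈ relCore K K₀,
      f x y₀ + g x y₀ ∈ -(C : Set Z))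
    (hnet : ∀ y ∈ K₀, NetCondition (C : Set Z) K₀ (fun x => f x y + g x y))
    (hquasi : CEssentiallyQuasimonotoneOn (C : Set Z) K₀ f)
    (hgconv : ∀ x ∈ K₀, CConvexOn (C : Set Z) K (g x))
    (hfconv : ∀ x ∈ K₀, CConvexOn (C : Set Z) K (f x))
    (hfdiag : ∀ x ∈ K₀, f x x ∈ -(C : Set Z) \ -interior (C : Set Z))
    (hgdiag : ∀ x ∈ K₀, g x x = 0) :
    ∃ x₀ ∈ K, ∀ y ∈ K, f x₀ y + g x₀ y ∉ -interior (C : Set Z) := by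
  let F : X → X → Z := fun x y => f x y + g x y
  have hFconv : ∀ x ∈ K₀, CConvexOn (C : Set Z) K (F x) := fun x hx =>
    (hfconv x hx).add (hgconv x hx)
  obtain ⟨x₀, hx₀, hsol⟩ : ∃ x ∈ K₀, ∀ y ∈ K₀, x ∈ {x | x ∈ K₀ ∧ F x y ∉ -interior (C : Set Z)} := by
    refine hK₀comp.kkm hK₀conv hK₀ne _ (fun y hy => (hnet y hy).isClosed hK₀comp.isClosed) ?_
    intro n y l hy hl hl1
    have hx : ∑ j, l j • y j ∈ K₀ := hK₀conv.sum_mem (fun i _ => hl i) hl1 fun i _ => hy i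
    set x := ∑ j, l j • y j with hxdef
    by_contra! h
    refine hquasi n y l hy hl hl1 ?_
    rw [← hxdef]
    have hF : ∀ i, l i ≠ 0 → -F x (y i) ∈ interior (C : Set Z) := fun i hi => by
      by_contra hFi
      exact h i hi ⟨hx, hFi⟩
    have h1 : ∑ i, l i • -F x (y i) ∈ interior (C : Set Z) := by
      -- Membership is known only for nonzero weights, which is all that `finsum_mem` asks.
      have := C.convex_coe.interior.finsum_mem (w := l) (z := fun i => -F x (y i)) hl
        (by rw [finsum_eq_sum_of_fintype, hl1]) hF
      rwa [finsum_eq_sum_of_fintype] at this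
    have h2 := (hgconv x hx).sum_smul_sub_mem hKconv (fun i _ => hl i) hl1
      (fun i (_ : i ∈ Finset.univ) => hK₀K (hy i))
    rw [← hxdef, hgdiag x hx, sub_zero] at h2
    rw [Set.mem_neg]
    convert C.add_mem_interior h2 h1 using 1
    simp only [F, smul_neg, smul_add, Finset.sum_neg_distrib, Finset.sum_add_distrib]
    abel
  have hcore : ∀ u ∈ relCore K K₀, F x₀ u ∈ -(C : Set Z) →
      ∀ v ∈ K, F x₀ v ∉ -interior (C : Set Z) := by
    rintro u ⟨huK₀, hu⟩ hFu v hv hFv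
    obtain ⟨_, hwK₀, t, ht, rfl⟩ := hu v hv
    exact (hsol _ hwK₀).2 ((hFconv x₀ hx₀).mem_neg_interior (hK₀K huK₀) hv hFu hFv ht)
  refine ⟨x₀, hK₀K hx₀, ?_⟩
  by_cases hx₀core : x₀ ∈ relCore K K₀
  · refine hcore x₀ hx₀core ?_
    simpa only [F, hgdiag x₀ hx₀, add_zero] using (hfdiag x₀ hx₀).1
  · obtain ⟨y₀, hy₀, hFy₀⟩ := hcoercive x₀ ⟨hx₀, hx₀core⟩
    exact hcore y₀ hy₀ hFy₀
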